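/- Let $d\ge 0$ be an integer, $\hbar>0$, $\lambda\in\mathbf R$, $\mathfrak H:=L^2(\mathbf R^d;\mathbf C)$ and $D_y:=-i\nabla_y$. **Definitions.** A density operator on $\mathfrak H$ is a bounded operator $R=R^*\ge 0$ with $\operatorname{trace}(R)=1$. One writes $R\in\mathcal D^2(\mathfrak H)$ if moreover $\operatorname{trace}\big(R^{1/2}(-\hbar^2\Delta_y+|y|^2)R^{1/2}\big)<\infty$. Here and below, for a bounded $T=T^*\ge0$ and a possibly unbounded $A=A^*\ge 0$, $\operatorname{trace}(T^{1/2}AT^{1/2})\in[0,\infty]$ is $\sum_j\|A^{1/2}T^{1/2}e_j\|^2$ for an orthonormal basis $(e_j)$ of $\mathfrak H$, with $\|A^{1/2}\psi\|^2:=\infty$ if $\psi\notin\operatorname{Dom}(A^{1/2})$. For $q,p\in\mathbf R^d$ the coherent state is $|q,p\rangle(x):=(\pi\hbar)^{-d/4}e^{-|x-q|^2/2\hbar}e^{ip\cdot(x-q)/\hbar}$. The Töplitz operator of a Borel probability measure $\mu$ on $\mathbf R^d\times\mathbf R^d$ is $$\mathrm{OP}^T_\hbar[(2\pi\hbar)^d\mu]:=\iint_{\mathbf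 R^d\times\mathbf R^d}|q,p\rangle\langle q,p|\,\mu(dq\,dp).$$ Let $f$ be a probability density on $\mathbf R^d\times\mathbf R^d$ (with respect to Lebesgue measure) and let $R$ be a density operator. $\mathcal C(f,R)$ is the set of (weakly) measurable operator-valued functions $(x,\xi)\mapsto Q(x,\xi)$ with $Q(x,\xi)=Q(x,\xi)^*\ge0$ and $\operatorname{trace}(Q(x,\xi))=f(x,\xi)$ for a.e. $(x,\xi)$, and $\iint Q(x,\xi)\,dx\,d\xi=R$ (weakly). With $c_\lambda(x,\xi,y,\hbar D_y):=\lambda^2|x-y|^2+|\xi-\hbar D_y|^2$, set $$E_{\hbar,\lambda}(f,R):=\inf_{Q\in\mathcal C(f,R)}\left(\iint_{\mathbf R^d\times\mathbf R^d}\operatorname{trace}\big(Q(x,\xi)^{1/2}c_\lambda(x,\xi,y,\hbar D_y)Q(x,\xi)^{1/2}\big)\,dx\,d\xi\right)^{1/2}\in[0,\infty].$$ Finally $\operatorname{dist}_{\mathrm{MK},2}(f,\mu)\in[0,\infty]$ is the Monge–Kantorovich distance of exponent 2: $$\operatorname{dist}_{\mathrm{MK},2}(f,\mu):=\inf_P\left(\iint\big(|x-q|^2+|\xi-p|^2\big)\,P(dx\,d\xi\,dq\,dp)\right)^{1/2},$$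 where $P$ runs through the Borel measures on $(\mathbf R^d\times\mathbf R^d)^2$ with marginals $f(x,\xi)\,dx\,d\xi$ and $\mu$. **Proposition.** Let $f$ be a probability density on $\mathbf R^d\times\mathbf R^d$, and let $\mu$ be a Borel probability measure on $\mathbf R^d\times\mathbf R^d$ such that $\iint(|q|^2+|p|^2)\,\mu(dq\,dp)<\infty$. Then $$\mathrm{OP}^T_\hbar[(2\pi\hbar)^d\mu]\in\mathcal D^2(\mathfrak H),$$ and $$E_{\hbar,\lambda}\big(f,\mathrm{OP}^T_\hbar[(2\pi\hbar)^d\mu]\big)^2\le\max(1,\lambda^2)\,\operatorname{dist}_{\mathrm{MK},2}(f,\mu)^2+\tfrac12(\lambda^2+1)\,d\,\hbar .$$ The inequality is one in $[0,\infty]$; no moment condition on $f$ is needed. -/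

import Mathlib

open MeasureTheory FourierTransform
open scoped ENNReal

namespace QuantumTransport

/-- Configuration space `ℝᵈ` with its Euclidean norm. -/
abbrev Space (d : ℕ) : Type := EuclideanSpace ℝ (Fin d)

/-- Phase space `ℝᵈ × ℝᵈ`; points are pairs (position, momentum). -/
abbrev Phase (d : ℕ) : Type := Space d × Space d

/-- The Hilbert space `𝓗 = L²(ℝᵈ; ℂ)`. -/
abbrev Hilb (d : ℕ) : Type := Lp ℂ 2 (volume : Measure (Space d))

/-- Bounded operators on `𝓗`. -/
abbrev Op (d : ℕ) : Type := Hilb d →L[ℂ] Hilb d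

/-! ### Traces of nonnegative operators on a Hilbert space -/

section Trace

variable {H : Type*} [NormedAddCommGroup H] [InnerProductSpace ℂ H] [CompleteSpace H]

/-- Index set of a fixed orthonormal (Hilbert) basis of `H`. -/
noncomputable def basisIndex (H : Type*) [NormedAddCommGroup H] [InnerProductSpace ℂ H]
    [CompleteSpace H] : Set H :=
  Classical.choose (exists_hilbertBasis ℂ H)

/-- A fixed orthonormal (Hilbert) basis of `H`. The traces below are traces of nonnegative
operators, and do not depend on this choice. -/
noncomputable def basis (H : Type*) [NormedAddCommGroup H] [InnerProductSpace ℂ H]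
    [CompleteSpace H] : HilbertBasis (basisIndex H) ℂ H :=
  Classical.choose (Classical.choose_spec (exists_hilbertBasis ℂ H))

/-- The nonnegative square root `T^{1/2}` of a bounded operator `T = T* ≥ 0`. -/
noncomputable def opSqrt (T : H →L[ℂ] H) : H →L[ℂ] H := CFC.sqrt T

/-- The trace, in `[0, ∞]`, of a bounded operator `T = T* ≥ 0`. -/
noncomputable def opTrace (T : H →L[ℂ] H) : ℝ≥0∞ :=
  ∑' i, ENNReal.ofReal (inner ℂ (basis H i) (T (basis H i))).re

/-- `trace (T^{1/2} A T^{1/2})`, in `[0, ∞]`, where `T = T* ≥ 0` is bounded and `A = A* ≥ 0` is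
a possibly unbounded operator, given by its closed quadratic form
`a ψ = ⟨ψ, A ψ⟩ = ‖A^{1/2} ψ‖²`, which takes the value `∞` off the domain of `A^{1/2}`. -/
noncomputable def traceSandwich (a : H → ℝ≥0∞) (T : H →L[ℂ] H) : ℝ≥0∞ :=
  ∑' i, a (opSqrt T (basis H i))

end Trace

/-! ### Quadratic forms of the position and momentum operators -/

/-- The form of the operator `|x - y|²` (multiplication, `y` being the variable of `ψ`):
`∫ |x - y|² |ψ(y)|² dy`. -/
noncomputable def positionForm {d : ℕ} (x : Space d) (ψ : Hilb d) : ℝ≥0∞ :=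
  ∫⁻ y, ENNReal.ofReal (‖x - y‖ ^ 2 * ‖ψ y‖ ^ 2)

/-- The form of the operator `|ξ - ħ D_y|²`, `D_y = -i ∇_y`. The Fourier transform is
`∫ exp (-2 π i k · y) ψ(y) dy`, extended to `L²`, and carries `ħ D_y` to multiplication
by `2 π ħ k`. -/
noncomputable def momentumForm {d : ℕ} (ħ : ℝ) (ξ : Space d) (ψ : Hilb d) : ℝ≥0∞ :=
  ∫⁻ k, ENNReal.ofReal (‖ξ - (2 * Real.pi * ħ) • k‖ ^ 2 * ‖(𝓕 ψ : Hilb d) k‖ ^ 2)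

/-- The form of the harmonic oscillator `-ħ² Δ_y + |y|²`. -/
noncomputable def oscillatorForm {d : ℕ} (ħ : ℝ) (ψ : Hilb d) : ℝ≥0∞ :=
  momentumForm ħ 0 ψ + positionForm 0 ψ

/-- The form of the quantum transportation cost
`c_λ(x, ξ, y, ħ D_y) = λ² |x - y|² + |ξ - ħ D_y|²`. -/
noncomputable def costForm {d : ℕ} (ħ lam : ℝ) (z : Phase d) (ψ : Hilb d) : ℝ≥0∞ :=
  ENNReal.ofReal (lam ^ 2) * positionForm z.1 ψ + momentumForm ħ z.2 ψ

/-! ### Density operators -/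

/-- `R = R* ≥ 0` and `trace R = 1`. -/
def IsDensityOperator {d : ℕ} (R : Op d) : Prop :=
  R.IsPositive ∧ opTrace R = 1

/-- Membership in `𝓓²(𝓗)`: a density operator `R` such that
`trace (R^{1/2} (-ħ² Δ_y + |y|²) R^{1/2}) < ∞`. -/
def IsDensityOperatorTwo {d : ℕ} (ħ : ℝ) (R : Op d) : Prop :=
  IsDensityOperator R ∧ traceSandwich (oscillatorForm ħ) R < ∞

/-! ### Classical densities and the Monge-Kantorovich distance -/

/-- `f` is a probability density on phase space, with respect to Lebesgue measure. -/
def IsProbDensity {d : ℕ} (f : Phase d → ℝ) : Prop :=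
  Integrable f ∧ (∀ᵐ z, 0 ≤ f z) ∧ ∫ z, f z = 1

/-- The measure `f(x, ξ) dx dξ`. -/
noncomputable def densityMeasure {d : ℕ} (f : Phase d → ℝ) : Measure (Phase d) :=
  (volume : Measure (Phase d)).withDensity (fun z => ENNReal.ofReal (f z))

/-- Finite second order moment: `∬ (|q|² + |p|²) μ(dq dp) < ∞`. -/
def HasFiniteSecondMoment {d : ℕ} (μ : Measure (Phase d)) : Prop :=
  ∫⁻ z, ENNReal.ofReal (‖z.1‖ ^ 2 + ‖z.2‖ ^ 2) ∂μ < ∞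

/-- The couplings (transport plans) of two Borel measures on phase space. -/
def classicalCouplings {d : ℕ} (μ ν : Measure (Phase d)) : Set (Measure (Phase d × Phase d)) :=
  {P | P.map Prod.fst = μ ∧ P.map Prod.snd = ν}

/-- The Monge-Kantorovich (Wasserstein) distance of exponent 2, in `[0, ∞]`, for the Euclidean
distance of `ℝᵈ × ℝᵈ`. -/
noncomputable def distMK2 {d : ℕ} (μ ν : Measure (Phase d)) : ℝ≥0∞ :=
  ⨅ P ∈ classicalCouplings μ ν,
    (∫⁻ w, ENNReal.ofReal (‖w.1.1 - w.2.1‖ ^ 2 + ‖w.1.2 - w.2.2‖ ^ 2) ∂P) ^ (1 / 2 : ℝ)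

/-! ### The pseudometric between classical and quantum densities -/

/-- `Q` is a coupling of the probability density `f` and the density operator `R`. Measurability
of the operator-valued function `Q` and its integral are understood in the weak sense; the
integrands `⟨φ, Q(z) ψ⟩` are integrable, since `trace Q = f` is. -/
structure IsCoupling {d : ℕ} (f : Phase d → ℝ) (R : Op d) (Q : Phase d → Op d) : Prop where
  measurable : ∀ φ ψ : Hilb d, AEMeasurable (fun z => inner ℂ φ (Q z ψ)) volume
  positive : ∀ᵐ z, (Q z).IsPositive
  trace_eq : ∀ᵐ z, opTrace (Q z) = ENNReal.ofReal (f z)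
  integral_eq : ∀ φ ψ : Hilb d, ∫ z, inner ℂ φ (Q z ψ) = inner ℂ φ (R ψ)

/-- The pseudometric `E_{ħ,λ}(f, R)`, in `[0, ∞]`. -/
noncomputable def pseudoDist {d : ℕ} (ħ lam : ℝ) (f : Phase d → ℝ) (R : Op d) : ℝ≥0∞ :=
  ⨅ Q ∈ {Q : Phase d → Op d | IsCoupling f R Q},
    (∫⁻ z, traceSandwich (costForm ħ lam z) (Q z)) ^ (1 / 2 : ℝ)

/-! ### Coherent states and Töplitz operators -/

/-- The wave function `x ↦ (π ħ)^{-d/4} exp (-|x - q|² / 2ħ) exp (i p · (x - q) / ħ)`. -/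
noncomputable def coherentFun {d : ℕ} (ħ : ℝ) (z : Phase d) (x : Space d) : ℂ :=
  (((Real.pi * ħ) ^ (-(d : ℝ) / 4) * Real.exp (-‖x - z.1‖ ^ 2 / (2 * ħ)) : ℝ) : ℂ) *
    Complex.exp (Complex.I * ((inner ℝ z.2 (x - z.1) / ħ : ℝ) : ℂ))

theorem memLp_coherentFun {d : ℕ} {ħ : ℝ} (hħ : 0 < ħ) (z : Phase d) :
    MemLp (coherentFun ħ z) 2 (volume : Measure (Space d)) := by
  have hc : Continuous (coherentFun ħ z) := by
    unfold coherentFun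
    fun_prop
  rw [memLp_two_iff_integrable_sq_norm hc.aestronglyMeasurable]
  have h1 := (GaussianFourier.integrable_cexp_neg_mul_sq_norm_add (V := Space d)
    (b := ((1 / ħ : ℝ) : ℂ)) (by rw [Complex.ofReal_re]; positivity) 0 0).norm
  have h2 := (h1.comp_sub_right z.1).const_mul (((Real.pi * ħ) ^ (-(d : ℝ) / 4)) ^ 2)
  refine h2.congr (Filter.Eventually.of_forall fun x => ?_)
  have h3 : 0 ≤ (Real.pi * ħ) ^ (-(d : ℝ) / 4) := by positivity
  have h4 : ‖Complex.exp (Complex.I * ((inner ℝ z.2 (x - z.1) / ħ : ℝ) : ℂ))‖ = 1 := by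
    rw [mul_comm]
    exact Complex.norm_exp_ofReal_mul_I _
  have h5 : (-((1 / ħ : ℝ) : ℂ) * (‖x - z.1‖ : ℂ) ^ 2 + 0 * ((inner ℝ (0 : Space d) (x - z.1) : ℝ) : ℂ))
      = ((-‖x - z.1‖ ^ 2 / ħ : ℝ) : ℂ) := by
    push_cast
    ring
  simp only [coherentFun]
  rw [h5, ← Complex.ofReal_exp, norm_mul, h4, mul_one, Complex.norm_real, Complex.norm_real,
    Real.norm_of_nonneg (by positivity), Real.norm_of_nonneg (by positivity), mul_pow,
    ← Real.exp_nat_mul]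
  congr 2
  push_cast
  field_simp

/-- The Schrödinger coherent state `|q, p⟩ ∈ 𝓗`, for `z = (q, p)`. -/
noncomputable def coherentState {d : ℕ} {ħ : ℝ} (hħ : 0 < ħ) (z : Phase d) : Hilb d :=
  (memLp_coherentFun hħ z).toLp (coherentFun ħ z)

/-- The Töplitz operator `OP^T_ħ[(2 π ħ)^d μ] = ∬ |q, p⟩⟨q, p| μ(dq dp)`. -/
noncomputable def toeplitz {d : ℕ} {ħ : ℝ} (hħ : 0 < ħ) (μ : Measure (Phase d)) : Op d :=
  ∫ z, InnerProductSpace.rankOne ℂ (coherentState hħ z) (coherentState hħ z) ∂μ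

end QuantumTransport

/-! Every classical coupling P of f(z)dz and μ yields a quantum one. Disintegrate P = f(z) κ(z,dw)
dz and quantize in w: Q(z) = f(z) ∫ |w⟩⟨w| κ(z,dw). Coherent states are unit vectors, so trace Q(z)
= f(z). Integration in z keeps only the second marginal of P, so Q integrates to the Töplitz
operator of μ (`isCoupling_kernelCoupling`). The cost of Q is at most the P-integral of the cost
form at |w⟩. With z = (x, ξ) and w = (q, p), that form is λ²|x-q|² + |ξ-p|² + (λ²+1)dħ/2, because
the position and momentum densities of |q,p⟩ are Gaussians centred at q and p with variance ħ/2 in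
each coordinate (`costForm_coherentState`). It remains to bound 1 and λ² by their maximum and to
take the infimum over P.

The analytic point is trace(T^{1/2} A T^{1/2}) ≤ ∫ ⟨Ψ, AΨ⟩ dν for T = ∫ |Ψ⟩⟨Ψ| dν and unbounded A ≥
0 (`traceSandwich_averageRankOne_le`). If A = B*B with B bounded, equality holds: B T^{1/2} and its
adjoint have the same Hilbert-Schmidt norm, and ‖T^{1/2}v‖² = ⟨v, Tv⟩ = ∫ |⟨v, Ψ⟩|² dν. Truncated
multiplication operators, preceded by the Fourier transform for the momentum, approximate the
unbounded forms from below. The same inequality for the oscillator, with ν = μ, gives membership in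
𝓓². -/

namespace QuantumTransport

/-! ### Parseval's identity, Hilbert-Schmidt norms and square roots -/

section Trace

variable {H K : Type*} [NormedAddCommGroup H] [InnerProductSpace ℂ H]
  [NormedAddCommGroup K] [InnerProductSpace ℂ K]

/-- Parseval's identity in `[0, ∞]`. -/
theorem tsum_enorm_inner_sq {ι : Type*} (b : HilbertBasis ι ℂ H) (x : H) :
    ∑' i, ‖inner ℂ (b i) x‖ₑ ^ 2 = ‖x‖ₑ ^ 2 := by
  have h := b.hasSum_inner_mul_inner x x
  have h2 : HasSum (fun i => ‖inner ℂ (b i) x‖ ^ 2) (‖x‖ ^ 2) := by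
    have e : ∀ i, inner ℂ x (b i) * inner ℂ (b i) x = ((‖inner ℂ (b i) x‖ ^ 2 : ℝ) : ℂ) := by
      intro i
      rw [← inner_conj_symm x (b i), Complex.conj_mul']
      push_cast
      rfl
    have e2 : inner ℂ x x = ((‖x‖ ^ 2 : ℝ) : ℂ) :=
      (inner_self_eq_norm_sq_to_K x).trans (Complex.ofReal_pow _ _).symm
    simp_rw [e, e2] at h
    exact_mod_cast h
  have h3 := ENNReal.ofReal_tsum_of_nonneg (f := fun i => ‖inner ℂ (b i) x‖ ^ 2)
    (fun i => by positivity) h2.summable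
  rw [h2.tsum_eq] at h3
  simpa [ENNReal.ofReal_pow, ofReal_norm] using h3.symm

variable [CompleteSpace H] [CompleteSpace K]

/-- Distinct basis vectors lie at distance √2, so balls of radius 1/2 about them are disjoint.
Countability is what allows sums over the basis to be exchanged with integrals. -/
instance [TopologicalSpace.SeparableSpace H] : Countable (basisIndex H) := by
  have ho := (basis H).orthonormal
  have hd : Pairwise (Function.onFun Disjoint fun i => Metric.ball (basis H i) (1 / 2)) := by
    intro i j hij
    refine Metric.ball_disjoint_ball ?_
    have h := norm_sub_sq (𝕜 := ℂ) (basis H i) (basis H j)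
    rw [ho.1, ho.1, ho.2 hij] at h
    norm_num at h
    rw [dist_eq_norm]
    nlinarith [norm_nonneg (basis H i - basis H j)]
  exact Pairwise.countable_of_isOpen_disjoint hd (fun i => Metric.isOpen_ball)
    (fun i => Metric.nonempty_ball.2 (by norm_num))

/-- The Hilbert-Schmidt norm of `B S` agrees with the one of its adjoint. -/
theorem tsum_enorm_comp_sq (B : H →L[ℂ] K) {S : H →L[ℂ] H} (hS : IsSelfAdjoint S) :
    ∑' i, ‖B (S (basis H i))‖ₑ ^ 2 =
      ∑' j, ‖S (ContinuousLinearMap.adjoint B (basis K j))‖ₑ ^ 2 := by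
  calc ∑' i, ‖B (S (basis H i))‖ₑ ^ 2
      = ∑' i, ∑' j, ‖inner ℂ (basis K j) (B (S (basis H i)))‖ₑ ^ 2 := by
        simp_rw [tsum_enorm_inner_sq]
    _ = ∑' j, ∑' i, ‖inner ℂ (basis H i) (S (ContinuousLinearMap.adjoint B (basis K j)))‖ₑ ^ 2 := by
        rw [ENNReal.tsum_comm]
        refine tsum_congr fun j => tsum_congr fun i => ?_
        rw [← ContinuousLinearMap.adjoint_inner_left, ← ContinuousLinearMap.adjoint_inner_left,
          ← ContinuousLinearMap.star_eq_adjoint S, hS.star_eq, ← inner_conj_symm, RCLike.enorm_conj]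
    _ = _ := by simp_rw [tsum_enorm_inner_sq]

theorem isSelfAdjoint_opSqrt (T : H →L[ℂ] H) : IsSelfAdjoint (opSqrt T) :=
  IsSelfAdjoint.of_nonneg (CFC.sqrt_nonneg T)

theorem enorm_opSqrt_sq {T : H →L[ℂ] H} (hT : T.IsPositive) (x : H) :
    ‖opSqrt T x‖ₑ ^ 2 = ENNReal.ofReal (inner ℂ x (T x)).re := by
  have h : opSqrt T * opSqrt T = T :=
    CFC.sqrt_mul_sqrt_self T ((ContinuousLinearMap.nonneg_iff_isPositive T).2 hT)
  have h2 : inner ℂ x (T x) = inner ℂ (opSqrt T x) (opSqrt T x) := by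
    conv_lhs => rw [← h]
    rw [mul_apply_eq_comp, ← ContinuousLinearMap.adjoint_inner_left,
      ← ContinuousLinearMap.star_eq_adjoint, (isSelfAdjoint_opSqrt T).star_eq]
  rw [h2, inner_self_eq_norm_sq_to_K, ← ofReal_norm, ← ENNReal.ofReal_pow (norm_nonneg _)]
  norm_cast

end Trace

/-! ### Averages of rank one operators and their traces -/

section Average

variable {H K : Type*} [NormedAddCommGroup H] [InnerProductSpace ℂ H]
  [NormedAddCommGroup K] [InnerProductSpace ℂ K]
  {Z : Type*} [MeasurableSpace Z] {ν : Measure Z} {Ψ : Z → H}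

theorem integrable_inner_mul_inner
    (h : Integrable (fun z => InnerProductSpace.rankOne ℂ (Ψ z) (Ψ z)) ν) (x y : H) :
    Integrable (fun z => inner ℂ (Ψ z) y * inner ℂ x (Ψ z)) ν := by
  have := (h.apply_continuousLinearMap y).const_inner (𝕜 := ℂ) x
  simpa [inner_smul_right] using this

variable [CompleteSpace H] [CompleteSpace K]

/-- The average `∫ |Ψ z⟩⟨Ψ z| ν(dz)` of rank one operators. -/
noncomputable def averageRankOne (ν : Measure Z) (Ψ : Z → H) : H →L[ℂ] H :=
  ∫ z, InnerProductSpace.rankOne ℂ (Ψ z) (Ψ z) ∂ν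

theorem inner_averageRankOne
    (h : Integrable (fun z => InnerProductSpace.rankOne ℂ (Ψ z) (Ψ z)) ν) (x y : H) :
    inner ℂ x (averageRankOne ν Ψ y) = ∫ z, inner ℂ (Ψ z) y * inner ℂ x (Ψ z) ∂ν := by
  rw [averageRankOne, ContinuousLinearMap.integral_apply h,
    ← integral_inner (h.apply_continuousLinearMap y)]
  simp [inner_smul_right]

theorem ofReal_re_inner_averageRankOne
    (h : Integrable (fun z => InnerProductSpace.rankOne ℂ (Ψ z) (Ψ z)) ν) (x : H) :
    ENNReal.ofReal (inner ℂ x (averageRankOne ν Ψ x)).re = ∫⁻ z, ‖inner ℂ x (Ψ z)‖ₑ ^ 2 ∂ν := by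
  have hz : ∀ z, inner ℂ (Ψ z) x * inner ℂ x (Ψ z) = ((‖inner ℂ x (Ψ z)‖ ^ 2 : ℝ) : ℂ) := by
    intro z
    rw [← inner_conj_symm (Ψ z) x, Complex.conj_mul']
    push_cast
    rfl
  have hi := integrable_inner_mul_inner h x x
  simp_rw [hz] at hi
  rw [inner_averageRankOne h]
  simp_rw [hz]
  rw [integral_complex_ofReal, Complex.ofReal_re, ofReal_integral_eq_lintegral_ofReal]
  · simp [ENNReal.ofReal_pow, ofReal_norm]
  · exact hi.re
  · exact Filter.Eventually.of_forall fun z => by positivity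

theorem isPositive_averageRankOne
    (h : Integrable (fun z => InnerProductSpace.rankOne ℂ (Ψ z) (Ψ z)) ν) :
    (averageRankOne ν Ψ).IsPositive := by
  rw [ContinuousLinearMap.isPositive_def']
  constructor
  · rw [ContinuousLinearMap.isSelfAdjoint_iff_isSymmetric]
    intro x y
    change inner ℂ (averageRankOne ν Ψ x) y = inner ℂ x (averageRankOne ν Ψ y)
    rw [← inner_conj_symm, inner_averageRankOne h, inner_averageRankOne h, ← integral_conj]
    refine integral_congr_ae (Filter.Eventually.of_forall fun z => ?_)
    simp [mul_comm]
  · intro x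
    rw [ContinuousLinearMap.reApplyInnerSelf_apply, inner_re_symm, inner_averageRankOne h,
      ← integral_re (integrable_inner_mul_inner h x x)]
    refine integral_nonneg fun z => ?_
    rw [← inner_conj_symm (Ψ z) x]
    simp only [RCLike.conj_mul]
    norm_cast
    positivity

theorem opTrace_averageRankOne [TopologicalSpace.SeparableSpace H] (hm : AEStronglyMeasurable Ψ ν)
    (h : Integrable (fun z => InnerProductSpace.rankOne ℂ (Ψ z) (Ψ z)) ν) :
    opTrace (averageRankOne ν Ψ) = ∫⁻ z, ‖Ψ z‖ₑ ^ 2 ∂ν := by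
  simp_rw [opTrace, ofReal_re_inner_averageRankOne h]
  rw [← lintegral_tsum]
  · simp_rw [tsum_enorm_inner_sq]
  · exact fun i => (hm.const_inner (𝕜 := ℂ)).enorm.pow_const 2

/-- `trace (T^{1/2} B* B T^{1/2}) = ∫ ‖B Ψ‖² dν` for `T = ∫ |Ψ⟩⟨Ψ| dν` and bounded `B`. -/
theorem tsum_enorm_opSqrt_averageRankOne [TopologicalSpace.SeparableSpace K]
    (hm : AEStronglyMeasurable Ψ ν)
    (h : Integrable (fun z => InnerProductSpace.rankOne ℂ (Ψ z) (Ψ z)) ν) (B : H →L[ℂ] K) :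
    ∑' i, ‖B (opSqrt (averageRankOne ν Ψ) (basis H i))‖ₑ ^ 2 = ∫⁻ z, ‖B (Ψ z)‖ₑ ^ 2 ∂ν := by
  -- After passing to the adjoint the square root acts last, so its squared norm is a quadratic form
  -- of the average itself and the root disappears.
  rw [tsum_enorm_comp_sq B (isSelfAdjoint_opSqrt _)]
  simp_rw [enorm_opSqrt_sq (isPositive_averageRankOne h), ofReal_re_inner_averageRankOne h,
    ContinuousLinearMap.adjoint_inner_left]
  rw [← lintegral_tsum]
  · simp_rw [tsum_enorm_inner_sq]
  · have hBm := B.continuous.comp_aestronglyMeasurable hm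
    exact fun i => (hBm.const_inner (𝕜 := ℂ)).enorm.pow_const 2

/-- A form which is a monotone limit of bounded forms. -/
theorem traceSandwich_averageRankOne_le [TopologicalSpace.SeparableSpace K]
    (hm : AEStronglyMeasurable Ψ ν)
    (h : Integrable (fun z => InnerProductSpace.rankOne ℂ (Ψ z) (Ψ z)) ν) {a : H → ℝ≥0∞}
    (B : ℕ → H →L[ℂ] K) (hB : ∀ ψ, Monotone fun n => ‖B n ψ‖ₑ ^ 2)
    (ha : ∀ ψ, a ψ = ⨆ n, ‖B n ψ‖ₑ ^ 2) :
    traceSandwich a (averageRankOne ν Ψ) ≤ ∫⁻ z, a (Ψ z) ∂ν := by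
  -- Finite partial sums commute with the monotone limit in n, so only bounded forms remain to be
  -- estimated.
  rw [traceSandwich, ENNReal.tsum_eq_iSup_sum]
  refine iSup_le fun s => ?_
  simp_rw [ha]
  rw [ENNReal.finsetSum_iSup_of_monotone fun i => hB _]
  refine iSup_le fun n => ?_
  calc _ ≤ ∑' i, ‖B n (opSqrt (averageRankOne ν Ψ) (basis H i))‖ₑ ^ 2 := ENNReal.sum_le_tsum s
    _ = ∫⁻ z, ‖B n (Ψ z)‖ₑ ^ 2 ∂ν := tsum_enorm_opSqrt_averageRankOne hm h _
    _ ≤ _ := lintegral_mono fun z => le_iSup (fun n => ‖B n (Ψ z)‖ₑ ^ 2) n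

end Average

/-! ### Multiplication operators -/

section Mul

variable {d : ℕ}

/-- Multiplication by `min (m y) n`. -/
noncomputable def truncMul {m : Space d → ℝ} (hm : Measurable m) (n : ℕ) : Op d :=
  (ContinuousLinearMap.mul ℂ ℂ).holderL volume ∞ 2 2
    ((memLp_top_of_bound (f := fun y => ((min |m y| n : ℝ) : ℂ)) (by fun_prop) n
      (Filter.Eventually.of_forall fun y => by
        rw [Complex.norm_real, Real.norm_of_nonneg (by positivity)]
        exact min_le_right _ _)).toLp _)

theorem coeFn_truncMul {m : Space d → ℝ} (hm : Measurable m) (n : ℕ) (ψ : Hilb d) :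
    truncMul hm n ψ =ᵐ[volume] fun y => ((min |m y| n : ℝ) : ℂ) * ψ y := by
  rw [truncMul, ContinuousLinearMap.holderL_apply_apply]
  refine ((ContinuousLinearMap.mul ℂ ℂ).coeFn_holder _ _).trans ?_
  filter_upwards [MemLp.coeFn_toLp (memLp_top_of_bound
    (f := fun y => ((min |m y| n : ℝ) : ℂ)) (μ := volume) (by fun_prop) n
      (Filter.Eventually.of_forall fun y => by
        rw [Complex.norm_real, Real.norm_of_nonneg (by positivity)]
        exact min_le_right _ _))] with y hy
  rw [hy]
  rfl

theorem enorm_Lp_two_sq (ψ : Hilb d) : ‖ψ‖ₑ ^ 2 = ∫⁻ y, ‖ψ y‖ₑ ^ 2 := by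
  rw [Lp.enorm_def, eLpNorm_eq_lintegral_rpow_enorm_toReal (by norm_num) (by norm_num),
    ← ENNReal.rpow_natCast, ← ENNReal.rpow_mul]
  norm_num

theorem enorm_truncMul_sq {m : Space d → ℝ} (hm : Measurable m) (n : ℕ) (ψ : Hilb d) :
    ‖truncMul hm n ψ‖ₑ ^ 2 = ∫⁻ y, ENNReal.ofReal (min |m y| n) ^ 2 * ‖ψ y‖ₑ ^ 2 := by
  rw [enorm_Lp_two_sq]
  refine lintegral_congr_ae ?_
  filter_upwards [coeFn_truncMul hm n ψ] with y hy
  rw [hy, enorm_mul, mul_pow, ← ofReal_norm (((min |m y| n : ℝ) : ℂ)), Complex.norm_real,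
    Real.norm_of_nonneg (by positivity)]

theorem monotone_enorm_truncMul_sq {m : Space d → ℝ} (hm : Measurable m) (ψ : Hilb d) :
    Monotone fun n => ‖truncMul hm n ψ‖ₑ ^ 2 := by
  intro n k hnk
  simp only [enorm_truncMul_sq]
  gcongr

/-- Monotone convergence: for each y the truncation is inactive once n ≥ |m y|. -/
theorem iSup_enorm_truncMul_sq {m : Space d → ℝ} (hm : Measurable m) (ψ : Hilb d) :
    ⨆ n, ‖truncMul hm n ψ‖ₑ ^ 2 = ∫⁻ y, ENNReal.ofReal (m y ^ 2 * ‖ψ y‖ ^ 2) := by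
  simp_rw [enorm_truncMul_sq]
  rw [← lintegral_iSup' ]
  · refine lintegral_congr fun y => ?_
    have hy : ENNReal.ofReal (m y ^ 2 * ‖ψ y‖ ^ 2) = ENNReal.ofReal |m y| ^ 2 * ‖ψ y‖ₑ ^ 2 := by
      rw [← sq_abs, ENNReal.ofReal_mul (by positivity), ENNReal.ofReal_pow (by positivity),
        ENNReal.ofReal_pow (by positivity), ofReal_norm]
    rw [hy]
    refine le_antisymm (iSup_le fun n => ?_) ?_
    · gcongr
      exact min_le_left _ _
    · obtain ⟨n, hn⟩ := exists_nat_ge |m y|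
      refine le_iSup_of_le n ?_
      rw [min_eq_left hn]
  · intro n
    have := (Lp.aestronglyMeasurable ψ).enorm
    fun_prop
  · refine Filter.Eventually.of_forall fun y n k hnk => ?_
    dsimp only
    gcongr

end Mul

/-! ### Trace bounds for the position and momentum forms -/

section Forms

instance {d : ℕ} : TopologicalSpace.SeparableSpace (Hilb d) :=
  haveI : Fact ((2 : ℝ≥0∞) ≠ ∞) := ⟨by norm_num⟩
  haveI := Lp.SecondCountableTopology (μ := (volume : Measure (Space d))) (E := ℂ) (p := 2)
  inferInstance

variable {d : ℕ} {Z : Type*} [MeasurableSpace Z] {ν : Measure Z} {Ψ : Z → Hilb d}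

theorem traceSandwich_positionForm_le (hm : AEStronglyMeasurable Ψ ν)
    (h : Integrable (fun z => InnerProductSpace.rankOne ℂ (Ψ z) (Ψ z)) ν) (x : Space d) :
    traceSandwich (positionForm x) (averageRankOne ν Ψ) ≤ ∫⁻ z, positionForm x (Ψ z) ∂ν := by
  have hx : Measurable fun y : Space d => ‖x - y‖ := by fun_prop
  exact traceSandwich_averageRankOne_le hm h (fun n => truncMul hx n)
    (monotone_enorm_truncMul_sq hx) (fun ψ => (iSup_enorm_truncMul_sq hx ψ).symm)

theorem traceSandwich_momentumForm_le (hm : AEStronglyMeasurable Ψ ν)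
    (h : Integrable (fun z => InnerProductSpace.rankOne ℂ (Ψ z) (Ψ z)) ν) (ħ : ℝ) (ξ : Space d) :
    traceSandwich (momentumForm ħ ξ) (averageRankOne ν Ψ) ≤ ∫⁻ z, momentumForm ħ ξ (Ψ z) ∂ν := by
  have hx : Measurable fun k : Space d => ‖ξ - (2 * Real.pi * ħ) • k‖ := by fun_prop
  exact traceSandwich_averageRankOne_le hm h
    (fun n => truncMul hx n ∘L (fourierCLM ℂ (Hilb d)))
    (fun ψ => monotone_enorm_truncMul_sq hx (𝓕 ψ))
    (fun ψ => (iSup_enorm_truncMul_sq hx (𝓕 ψ)).symm)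

theorem traceSandwich_costForm (ħ lam : ℝ) (z : Phase d) (T : Op d) :
    traceSandwich (costForm ħ lam z) T =
      ENNReal.ofReal (lam ^ 2) * traceSandwich (positionForm z.1) T +
        traceSandwich (momentumForm ħ z.2) T := by
  simp only [traceSandwich, costForm]
  rw [ENNReal.tsum_add, ENNReal.tsum_mul_left]

theorem traceSandwich_oscillatorForm (ħ : ℝ) (T : Op d) :
    traceSandwich (oscillatorForm ħ) T =
      traceSandwich (momentumForm ħ 0) T + traceSandwich (positionForm 0) T := by
  simp only [traceSandwich, oscillatorForm]
  rw [ENNReal.tsum_add]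

end Forms

/-! ### Second moments of Gaussian densities -/

section Gaussian

open ProbabilityTheory
open scoped NNReal

variable {d : ℕ}

/-- The density of the Gaussian measure on `ℝᵈ` of mean `q` and covariance `v` times the identity. -/
noncomputable def gaussianDensity (v : ℝ≥0) (q y : Space d) : ℝ :=
  ∏ i, gaussianPDFReal (q i) v (y i)

theorem gaussianDensity_eq (v : ℝ≥0) (q y : Space d) :
    gaussianDensity v q y =
      (√(2 * Real.pi * v))⁻¹ ^ d * Real.exp (-‖y - q‖ ^ 2 / (2 * v)) := by
  simp only [gaussianDensity, gaussianPDFReal_def, Finset.prod_mul_distrib, Finset.prod_const,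
    Finset.card_univ, Fintype.card_fin, ← Real.exp_sum, EuclideanSpace.real_norm_sq_eq,
    ← Finset.sum_div, Finset.sum_neg_distrib, PiLp.sub_apply]

theorem gaussianDensity_nonneg (v : ℝ≥0) (q y : Space d) : 0 ≤ gaussianDensity v q y :=
  Finset.prod_nonneg fun _ _ => gaussianPDFReal_nonneg _ _ _

theorem integrable_sq_sub_mul_gaussianPDFReal (a q : ℝ) {v : ℝ≥0} (hv : v ≠ 0) :
    Integrable fun y => (a - y) ^ 2 * gaussianPDFReal q v y := by
  have h : Integrable (fun y : ℝ => (a - y) ^ 2) (gaussianReal q v) :=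
    (((memLp_const a).sub (memLp_id_gaussianReal (μ := q) (v := v) 2)).integrable_sq)
  rw [gaussianReal_of_var_ne_zero _ hv, gaussianPDF_def,
    integrable_withDensity_iff (by fun_prop) (by simp)] at h
  simpa [ENNReal.toReal_ofReal, gaussianPDFReal_nonneg] using h

/-- The second moment of y - a is its variance, which the shift leaves equal to v, plus the square
of its mean q - a. -/
theorem integral_sq_sub_mul_gaussianPDFReal (a q : ℝ) {v : ℝ≥0} (hv : v ≠ 0) :
    ∫ y, (a - y) ^ 2 * gaussianPDFReal q v y = (a - q) ^ 2 + v := by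
  have hm := memLp_id_gaussianReal (μ := q) (v := v) 2
  have h1 : Var[fun y => y - a; gaussianReal q v] = v := by
    rw [variance_sub_const (by fun_prop), variance_fun_id_gaussianReal]
  have h2 : ∫ y, (y - a) ∂(gaussianReal q v) = q - a := by
    rw [integral_sub (f := fun y => y) (hm.integrable (by norm_num)) (integrable_const a)]
    simp
  have h3 : ∫ y, (a - y) ^ 2 ∂(gaussianReal q v) = (a - q) ^ 2 + v := by
    rw [variance_eq_sub (X := fun y => y - a) (hm.sub (memLp_const a)), h2] at h1
    simp only [Pi.pow_apply] at h1
    simp_rw [sub_sq_comm a]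
    linarith
  rw [← h3, integral_gaussianReal_eq_integral_smul hv]
  simp [mul_comm]

/-- Each summand is a product of functions of one coordinate. -/
theorem sq_norm_sub_mul_gaussianDensity (v : ℝ≥0) (x q y : Space d) :
    ‖x - y‖ ^ 2 * gaussianDensity v q y =
      ∑ i, ∏ j, (if j = i then (x j - y j) ^ 2 else 1) * gaussianPDFReal (q j) v (y j) := by
  simp_rw [Finset.prod_mul_distrib, Finset.prod_ite_eq', ← Finset.sum_mul]
  simp [EuclideanSpace.real_norm_sq_eq, gaussianDensity]

theorem integrable_ite_sq_sub_mul_gaussianPDFReal (p : Prop) [Decidable p] (a q : ℝ) {v : ℝ≥0}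
    (hv : v ≠ 0) :
    Integrable fun y => (if p then (a - y) ^ 2 else 1) * gaussianPDFReal q v y := by
  split_ifs
  · exact integrable_sq_sub_mul_gaussianPDFReal a q hv
  · simpa using integrable_gaussianPDFReal q v

theorem integrable_gaussianDensity (v : ℝ≥0) (q : Space d) :
    Integrable (gaussianDensity v q) := by
  rw [← (PiLp.volume_preserving_toLp (Fin d)).integrable_comp_emb
    (MeasurableEquiv.toLp 2 _).measurableEmbedding]
  exact Integrable.fintype_prod (μ := fun _ => volume)
    (f := fun i => gaussianPDFReal (q i) v) fun i => integrable_gaussianPDFReal _ _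

theorem integrable_prod_ite_sq_sub_mul_gaussianPDFReal (x q : Space d) {v : ℝ≥0} (hv : v ≠ 0)
    (i : Fin d) :
    Integrable fun y : Space d =>
      ∏ j, (if j = i then (x j - y j) ^ 2 else 1) * gaussianPDFReal (q j) v (y j) := by
  rw [← (PiLp.volume_preserving_toLp (Fin d)).integrable_comp_emb
    (MeasurableEquiv.toLp 2 _).measurableEmbedding]
  exact Integrable.fintype_prod (μ := fun _ => volume)
    (f := fun j y => (if j = i then (x j - y) ^ 2 else 1) * gaussianPDFReal (q j) v y)
    fun j => integrable_ite_sq_sub_mul_gaussianPDFReal _ _ _ hv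

theorem integrable_sq_norm_sub_mul_gaussianDensity (x q : Space d) {v : ℝ≥0} (hv : v ≠ 0) :
    Integrable fun y => ‖x - y‖ ^ 2 * gaussianDensity v q y := by
  simp_rw [sq_norm_sub_mul_gaussianDensity]
  exact integrable_finsetSum _ fun i _ => integrable_prod_ite_sq_sub_mul_gaussianPDFReal x q hv i

theorem integral_gaussianDensity (q : Space d) {v : ℝ≥0} (hv : v ≠ 0) :
    ∫ y, gaussianDensity v q y = 1 := by
  rw [← (PiLp.volume_preserving_toLp (Fin d)).integral_comp
    (MeasurableEquiv.toLp 2 _).measurableEmbedding]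
  refine (integral_fintype_prod_volume_eq_prod fun i y => gaussianPDFReal (q i) v y).trans ?_
  simp [integral_gaussianPDFReal_eq_one _ hv]

/-- By Fubini the i-th summand factors over the coordinates: the i-th factor is a second moment and
all others are total masses equal to 1. -/
theorem integral_sq_norm_sub_mul_gaussianDensity (x q : Space d) {v : ℝ≥0} (hv : v ≠ 0) :
    ∫ y, ‖x - y‖ ^ 2 * gaussianDensity v q y = ‖x - q‖ ^ 2 + d * v := by
  have hint : ∀ i : Fin d, ∫ y : Space d,
      ∏ j, (if j = i then (x j - y j) ^ 2 else 1) * gaussianPDFReal (q j) v (y j) =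
        (x i - q i) ^ 2 + v := by
    intro i
    rw [← (PiLp.volume_preserving_toLp (Fin d)).integral_comp
      (MeasurableEquiv.toLp 2 _).measurableEmbedding]
    refine (integral_fintype_prod_volume_eq_prod fun j y =>
      (if j = i then (x j - y) ^ 2 else 1) * gaussianPDFReal (q j) v y).trans ?_
    rw [Finset.prod_eq_single i]
    · simp [integral_sq_sub_mul_gaussianPDFReal _ _ hv]
    · intro j _ hj
      simp [hj, integral_gaussianPDFReal_eq_one _ hv]
    · simp
  simp_rw [sq_norm_sub_mul_gaussianDensity]
  rw [integral_finsetSum _ fun i _ =>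
    integrable_prod_ite_sq_sub_mul_gaussianPDFReal x q hv i]
  simp_rw [hint]
  simp [Finset.sum_add_distrib, EuclideanSpace.real_norm_sq_eq]

theorem lintegral_sq_norm_sub_mul_gaussianDensity (x q : Space d) {v : ℝ≥0} (hv : v ≠ 0) :
    ∫⁻ y, ENNReal.ofReal (‖x - y‖ ^ 2 * gaussianDensity v q y) =
      ENNReal.ofReal (‖x - q‖ ^ 2 + d * v) := by
  rw [← integral_sq_norm_sub_mul_gaussianDensity x q hv, ofReal_integral_eq_lintegral_ofReal
    (integrable_sq_norm_sub_mul_gaussianDensity x q hv)]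
  exact Filter.Eventually.of_forall fun y => mul_nonneg (by positivity) (gaussianDensity_nonneg _ _ _)

theorem lintegral_gaussianDensity (q : Space d) {v : ℝ≥0} (hv : v ≠ 0) :
    ∫⁻ y, ENNReal.ofReal (gaussianDensity v q y) = 1 := by
  rw [← ofReal_integral_eq_lintegral_ofReal (integrable_gaussianDensity v q),
    integral_gaussianDensity q hv, ENNReal.ofReal_one]
  exact Filter.Eventually.of_forall fun y => gaussianDensity_nonneg _ _ _

end Gaussian

/-! ### The Fourier transform on `L¹ ∩ L²` -/

/-- On `L¹ ∩ L²`, the Fourier transform of `L²` is given by the Fourier integral. -/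
theorem fourier_toLp {d : ℕ} {f : Space d → ℂ} (h1 : Integrable f) (h2 : MemLp f 2 volume)
    (h3 : MemLp (𝓕 f) 2 volume) : 𝓕 (h2.toLp f) = h3.toLp (𝓕 f) := by
  -- Both sides are compared as tempered distributions; the identity then becomes the multiplication
  -- formula ∫ ĝ f = ∫ g f̂ against Schwartz functions g.
  have hinj : Function.Injective
      (Lp.toTemperedDistributionCLM ℂ (volume : Measure (Space d)) 2) :=
    LinearMap.ker_eq_bot.1 Lp.ker_toTemperedDistributionCLM_eq_bot
  apply hinj
  change Lp.toTemperedDistribution (𝓕 (h2.toLp f)) = Lp.toTemperedDistribution (h3.toLp (𝓕 f))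
  rw [← Lp.fourier_toTemperedDistribution_eq]
  ext g
  rw [TemperedDistribution.fourier_apply, Lp.toTemperedDistribution_apply,
    Lp.toTemperedDistribution_apply]
  have e1 : ∫ x, 𝓕 g x • h2.toLp f x = ∫ x, 𝓕 g x • f x :=
    integral_congr_ae (by filter_upwards [h2.coeFn_toLp] with x hx; rw [hx])
  have e2 : ∫ x, g x • h3.toLp (𝓕 f) x = ∫ x, g x • 𝓕 f x :=
    integral_congr_ae (by filter_upwards [h3.coeFn_toLp] with x hx; rw [hx])
  rw [e1, e2]
  simpa using! VectorFourier.integral_fourierIntegral_smul_eq_flip (L := innerₗ (Space d))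
    Real.continuous_fourierChar continuous_inner g.integrable h1

/-! ### Coherent states -/

section Coherent

variable {d : ℕ} {ħ : ℝ}

theorem norm_coherentFun_sq (hħ : 0 < ħ) (z : Phase d) (y : Space d) :
    ‖coherentFun ħ z y‖ ^ 2 = gaussianDensity (ħ / 2).toNNReal z.1 y := by
  have hc : ((ħ / 2).toNNReal : ℝ) = ħ / 2 := Real.coe_toNNReal _ (by positivity)
  have h4 : ‖Complex.exp (Complex.I * ((inner ℝ z.2 (y - z.1) / ħ : ℝ) : ℂ))‖ = 1 := by
    rw [mul_comm]
    exact Complex.norm_exp_ofReal_mul_I _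
  rw [gaussianDensity_eq, coherentFun, norm_mul, h4, mul_one, Complex.norm_real,
    Real.norm_of_nonneg (by positivity), mul_pow, ← Real.exp_nat_mul, hc]
  congr 1
  · rw [← Real.rpow_natCast _ 2, ← Real.rpow_mul (by positivity), Real.sqrt_eq_rpow,
      ← Real.rpow_neg (by positivity), ← Real.rpow_natCast _ d, ← Real.rpow_mul (by positivity)]
    congr 1
    · ring
    · push_cast; ring
  · congr 1
    push_cast
    field_simp

theorem enorm_coherentState_sq (hħ : 0 < ħ) (z : Phase d) : ‖coherentState hħ z‖ₑ ^ 2 = 1 := by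
  have hv : (ħ / 2).toNNReal ≠ 0 := by simpa using hħ
  rw [enorm_Lp_two_sq, ← lintegral_gaussianDensity z.1 hv]
  refine lintegral_congr_ae ?_
  filter_upwards [(memLp_coherentFun hħ z).coeFn_toLp] with y hy
  rw [coherentState, hy, ← norm_coherentFun_sq hħ, ENNReal.ofReal_pow (by positivity), ofReal_norm]

theorem positionForm_coherentState (hħ : 0 < ħ) (x : Space d) (z : Phase d) :
    positionForm x (coherentState hħ z) = ENNReal.ofReal (‖x - z.1‖ ^ 2 + d * (ħ / 2)) := by
  have hv : (ħ / 2).toNNReal ≠ 0 := by simpa using hħ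
  have hc : ((ħ / 2).toNNReal : ℝ) = ħ / 2 := Real.coe_toNNReal _ (by positivity)
  have h := lintegral_sq_norm_sub_mul_gaussianDensity x z.1 hv
  rw [hc] at h
  rw [← h]
  refine lintegral_congr_ae ?_
  filter_upwards [(memLp_coherentFun hħ z).coeFn_toLp] with y hy
  rw [coherentState, hy, ← norm_coherentFun_sq hħ]

theorem continuous_coherentFun (z : Phase d) : Continuous (coherentFun ħ z) := by
  unfold coherentFun
  fun_prop

/-- This exhibits the coherent state as a translate of a modulated Gaussian, whose Fourier integral
is explicit. The translation only contributes a phase to it. -/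
theorem coherentFun_eq_comp_sub (hħ : 0 < ħ) (z : Phase d) :
    coherentFun ħ z = (((Real.pi * ħ) ^ (-(d : ℝ) / 4) : ℝ) : ℂ) •
      ((fun v : Space d => Complex.exp (-((1 / (2 * ħ) : ℝ) : ℂ) * ‖v‖ ^ 2 +
        2 * Real.pi * Complex.I * (inner ℝ ((2 * Real.pi * ħ)⁻¹ • z.2) v : ℝ))) ∘
          fun v => v + -z.1) := by
  ext x
  simp only [coherentFun, Pi.smul_apply, Function.comp_apply, smul_eq_mul, ← sub_eq_add_neg]
  push_cast
  rw [mul_assoc, ← Complex.exp_add, real_inner_smul_left]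
  congr 2
  have : (ħ : ℂ) ≠ 0 := by exact_mod_cast hħ.ne'
  have : (Real.pi : ℂ) ≠ 0 := by exact_mod_cast Real.pi_ne_zero
  push_cast
  field_simp

theorem integrable_coherentFun (hħ : 0 < ħ) (z : Phase d) : Integrable (coherentFun ħ z) := by
  rw [coherentFun_eq_comp_sub hħ]
  exact Integrable.smul _ ((GaussianFourier.integrable_cexp_neg_mul_sq_norm_add
    (by rw [Complex.ofReal_re]; positivity) _ _).comp_add_right _)

/-- The momentum density is again Gaussian of variance ħ/2, since the state has minimal uncertainty.
The factor (2πħ)^d is the Jacobian of k ↦ 2πħk. -/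
theorem norm_fourier_coherentFun_sq (hħ : 0 < ħ) (z : Phase d) (k : Space d) :
    ‖𝓕 (coherentFun ħ z) k‖ ^ 2 =
      (2 * Real.pi * ħ) ^ d * gaussianDensity (ħ / 2).toNNReal z.2 ((2 * Real.pi * ħ) • k) := by
  have hc : ((ħ / 2).toNNReal : ℝ) = ħ / 2 := Real.coe_toNNReal _ (by positivity)
  have hb : 0 < (((1 / (2 * ħ) : ℝ) : ℂ)).re := by rw [Complex.ofReal_re]; positivity
  have h := fourier_gaussian_innerProductSpace' (V := Space d) hb ((2 * Real.pi * ħ)⁻¹ • z.2) k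
  have e : ‖𝓕 (coherentFun ħ z) k‖ = (Real.pi * ħ) ^ (-(d : ℝ) / 4) *
      ((2 * Real.pi * ħ) ^ ((d : ℝ) / 2) *
        Real.exp (-‖(2 * Real.pi * ħ) • k - z.2‖ ^ 2 / (2 * ħ))) := by
    have hπ : (Real.pi : ℂ) / ((1 / (2 * ħ) : ℝ) : ℂ) = ((2 * Real.pi * ħ : ℝ) : ℂ) := by
      push_cast
      field_simp
    have hn : ‖(2 * Real.pi * ħ)⁻¹ • z.2 - k‖ =
        (2 * Real.pi * ħ)⁻¹ * ‖(2 * Real.pi * ħ) • k - z.2‖ := by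
      rw [norm_sub_rev, ← abs_of_pos (show 0 < (2 * Real.pi * ħ)⁻¹ by positivity),
        ← Real.norm_eq_abs, ← norm_smul, smul_sub, smul_smul, Real.norm_eq_abs,
        abs_of_pos (show 0 < (2 * Real.pi * ħ)⁻¹ by positivity),
        inv_mul_cancel₀ (by positivity), one_smul]
    have he : -(Real.pi : ℂ) ^ 2 * ‖(2 * Real.pi * ħ)⁻¹ • z.2 - k‖ ^ 2 / ((1 / (2 * ħ) : ℝ) : ℂ) =
        ((-‖(2 * Real.pi * ħ) • k - z.2‖ ^ 2 / (2 * ħ) : ℝ) : ℂ) := by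
      rw [hn]
      have : (ħ : ℂ) ≠ 0 := by exact_mod_cast hħ.ne'
      have : (Real.pi : ℂ) ≠ 0 := by exact_mod_cast Real.pi_ne_zero
      push_cast
      field_simp
    have hd : ((Module.finrank ℝ (Space d) : ℂ) / 2) = (((d : ℝ) / 2 : ℝ) : ℂ) := by
      rw [finrank_euclideanSpace_fin]
      push_cast
      rfl
    rw [hπ, he, hd, ← Complex.ofReal_cpow (by positivity), ← Complex.ofReal_exp] at h
    rw [coherentFun_eq_comp_sub hħ]
    change ‖VectorFourier.fourierIntegral Real.fourierChar volume (innerₗ (Space d)) _ k‖ = _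
    rw [VectorFourier.fourierIntegral_const_smul, Pi.smul_apply,
      VectorFourier.fourierIntegral_comp_add_right, norm_smul, Circle.norm_smul, Complex.norm_real,
      Real.norm_of_nonneg (by positivity)]
    congr 1
    refine (congrArg norm h).trans ?_
    rw [norm_mul, Complex.norm_real, Complex.norm_real, Real.norm_of_nonneg (by positivity),
      Real.norm_of_nonneg (by positivity)]
  rw [e, gaussianDensity_eq, hc, mul_pow, mul_pow, ← Real.exp_nat_mul, mul_left_comm,
    ← mul_assoc, ← mul_assoc]
  congr 1
  · rw [← Real.rpow_natCast _ 2, ← Real.rpow_natCast _ 2, ← Real.rpow_mul (by positivity),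
      ← Real.rpow_mul (by positivity), Real.sqrt_eq_rpow, ← Real.rpow_neg (by positivity),
      ← Real.rpow_natCast _ d, ← Real.rpow_natCast _ d, ← Real.rpow_mul (by positivity)]
    congr 2
    · push_cast; ring
    · ring
    · push_cast; ring
  · congr 1
    push_cast
    field_simp

theorem memLp_fourier_coherentFun (hħ : 0 < ħ) (z : Phase d) :
    MemLp (𝓕 (coherentFun ħ z)) 2 := by
  have hcont : Continuous (𝓕 (coherentFun ħ z)) :=
    VectorFourier.fourierIntegral_continuous Real.continuous_fourierChar continuous_inner
      (integrable_coherentFun hħ z)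
  rw [memLp_two_iff_integrable_sq_norm hcont.aestronglyMeasurable]
  simp_rw [norm_fourier_coherentFun_sq hħ]
  exact ((integrable_gaussianDensity _ z.2).comp_smul (by positivity)).const_mul _

theorem momentumForm_coherentState (hħ : 0 < ħ) (ξ : Space d) (z : Phase d) :
    momentumForm ħ ξ (coherentState hħ z) = ENNReal.ofReal (‖ξ - z.2‖ ^ 2 + d * (ħ / 2)) := by
  have hv : (ħ / 2).toNNReal ≠ 0 := by simpa using hħ
  have hc : ((ħ / 2).toNNReal : ℝ) = ħ / 2 := Real.coe_toNNReal _ (by positivity)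
  have hr : 0 < 2 * Real.pi * ħ := by positivity
  set F : Space d → ℝ := fun η => ‖ξ - η‖ ^ 2 * gaussianDensity (ħ / 2).toNNReal z.2 η with hF
  have hFi : Integrable F := integrable_sq_norm_sub_mul_gaussianDensity ξ z.2 hv
  have hFn : ∀ η, 0 ≤ F η := fun η => mul_nonneg (by positivity) (gaussianDensity_nonneg _ _ _)
  have h1 : momentumForm ħ ξ (coherentState hħ z) =
      ∫⁻ k, ENNReal.ofReal ((2 * Real.pi * ħ) ^ d * F ((2 * Real.pi * ħ) • k)) := by
    refine lintegral_congr_ae ?_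
    have := (memLp_fourier_coherentFun hħ z).coeFn_toLp
    rw [← fourier_toLp (integrable_coherentFun hħ z) (memLp_coherentFun hħ z)] at this
    filter_upwards [this] with k hk
    rw [coherentState, hk, norm_fourier_coherentFun_sq hħ, hF]
    congr 1
    ring
  rw [h1, ← ofReal_integral_eq_lintegral_ofReal ((hFi.comp_smul hr.ne').const_mul _)
    (Filter.Eventually.of_forall fun k => mul_nonneg (by positivity) (hFn _)),
    integral_const_mul, Measure.integral_comp_smul, finrank_euclideanSpace_fin, hF,
    integral_sq_norm_sub_mul_gaussianDensity ξ z.2 hv, hc, abs_of_nonneg (by positivity),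
    smul_eq_mul, ← mul_assoc, mul_inv_cancel₀ (by positivity), one_mul]

theorem costForm_coherentState (hħ : 0 < ħ) (lam : ℝ) (z w : Phase d) :
    costForm ħ lam z (coherentState hħ w) =
      ENNReal.ofReal (lam ^ 2 * ‖z.1 - w.1‖ ^ 2 + ‖z.2 - w.2‖ ^ 2 + (lam ^ 2 + 1) * d * ħ / 2) := by
  rw [costForm, positionForm_coherentState, momentumForm_coherentState,
    ← ENNReal.ofReal_mul (by positivity), ← ENNReal.ofReal_add (by positivity) (by positivity)]
  congr 1
  ring

theorem oscillatorForm_coherentState (hħ : 0 < ħ) (w : Phase d) :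
    oscillatorForm ħ (coherentState hħ w) =
      ENNReal.ofReal (‖w.1‖ ^ 2 + ‖w.2‖ ^ 2) + ENNReal.ofReal (d * ħ) := by
  rw [oscillatorForm, positionForm_coherentState, momentumForm_coherentState, zero_sub, zero_sub,
    norm_neg, norm_neg, ← ENNReal.ofReal_add (by positivity) (by positivity),
    ← ENNReal.ofReal_add (by positivity) (by positivity)]
  congr 1
  ring

/-- Dominated convergence in y. Continuity makes the rank one projections strongly measurable, hence
integrable in operator norm against finite measures. -/
theorem continuous_coherentState (hħ : 0 < ħ) : Continuous (coherentState (d := d) hħ) := by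
  refine continuous_iff_continuousAt.2 fun z₀ => ?_
  rw [ContinuousAt, tendsto_iff_edist_tendsto_0]
  set c : ℝ := (√(2 * Real.pi * (ħ / 2).toNNReal))⁻¹ ^ d with hcdef
  have hc : ((ħ / 2).toNNReal : ℝ) = ħ / 2 := Real.coe_toNNReal _ (by positivity)
  have hsq : ∀ z : Phase d, ‖coherentState hħ z - coherentState hħ z₀‖ₑ ^ 2 =
      ∫⁻ y, ENNReal.ofReal (‖coherentFun ħ z y - coherentFun ħ z₀ y‖ ^ 2) := by
    intro z
    rw [enorm_Lp_two_sq]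
    refine lintegral_congr_ae ?_
    filter_upwards [Lp.coeFn_sub (coherentState hħ z) (coherentState hħ z₀),
      (memLp_coherentFun hħ z).coeFn_toLp, (memLp_coherentFun hħ z₀).coeFn_toLp] with y h1 h2 h3
    rw [h1, Pi.sub_apply, coherentState, coherentState, h2, h3,
      ENNReal.ofReal_pow (norm_nonneg _), ofReal_norm]
  -- For centres at distance less than 1, |y-q₀|² ≤ 2|y-q|² + 2. Halving the rate of decay therefore
  -- gives a Gaussian centred at q₀ that dominates uniformly, at the price of the factor exp(1/ħ).
  have hbound : ∀ z : Phase d, ‖z.1 - z₀.1‖ < 1 → ∀ y, ‖coherentFun ħ z y‖ ^ 2 ≤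
      c * Real.exp (1 / ħ) * Real.exp (-‖y - z₀.1‖ ^ 2 / (2 * ħ)) := by
    intro z hz y
    rw [norm_coherentFun_sq hħ, gaussianDensity_eq, ← hcdef, hc, mul_assoc c, ← Real.exp_add]
    gcongr
    have h1 : ‖y - z₀.1‖ ≤ ‖y - z.1‖ + 1 :=
      (norm_sub_le_norm_sub_add_norm_sub y z.1 z₀.1).trans (by linarith)
    have h2 : ‖y - z₀.1‖ ^ 2 ≤ 2 * ‖y - z.1‖ ^ 2 + 2 := by
      nlinarith [norm_nonneg (y - z₀.1), sq_nonneg (‖y - z.1‖ - 1)]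
    rw [show 1 / ħ + -‖y - z₀.1‖ ^ 2 / (2 * ħ) = (2 - ‖y - z₀.1‖ ^ 2) / (2 * ħ) by field_simp; ring,
      show -‖y - z.1‖ ^ 2 / (2 * (ħ / 2)) = -(2 * ‖y - z.1‖ ^ 2) / (2 * ħ) by field_simp]
    gcongr
    linarith
  -- The factor 4 comes from |a-b|² ≤ 2|a|² + 2|b|², both terms obeying the bound above.
  have hint : Integrable fun y : Space d =>
      4 * (c * Real.exp (1 / ħ) * Real.exp (-‖y - z₀.1‖ ^ 2 / (2 * ħ))) := by
    have h := (integrable_gaussianDensity ħ.toNNReal z₀.1).const_mul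
      (4 * (c * Real.exp (1 / ħ) * √(2 * Real.pi * ħ) ^ d))
    refine h.congr (Filter.Eventually.of_forall fun y => ?_)
    simp only [gaussianDensity_eq, Real.coe_toNNReal _ hħ.le]
    have : √(2 * Real.pi * ħ) ^ d ≠ 0 := by positivity
    rw [inv_pow]
    field_simp
  have hlim : Filter.Tendsto (fun z : Phase d => ‖coherentState hħ z - coherentState hħ z₀‖ₑ ^ 2)
      (nhds z₀) (nhds 0) := by
    simp_rw [hsq]
    have h0 : (0 : ℝ≥0∞) = ∫⁻ _ : Space d, 0 := by simp
    rw [h0]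
    refine tendsto_lintegral_filter_of_dominated_convergence _
      (Filter.Eventually.of_forall fun z => ?_) ?_ hint.lintegral_lt_top.ne
      (Filter.Eventually.of_forall fun y => ?_)
    · have h1 := continuous_coherentFun (ħ := ħ) z
      have h2 := continuous_coherentFun (ħ := ħ) z₀
      fun_prop
    · have hnear : ∀ᶠ z in nhds z₀, ‖z.1 - z₀.1‖ < 1 := by
        have : Continuous fun z : Phase d => ‖z.1 - z₀.1‖ := by fun_prop
        exact this.continuousAt.eventually_lt continuousAt_const (by simp)
      filter_upwards [hnear] with z hz
      refine Filter.Eventually.of_forall fun y => ENNReal.ofReal_le_ofReal ?_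
      have h1 := hbound z hz y
      have h2 := hbound z₀ (by simp) y
      have h3 := norm_sub_le (coherentFun ħ z y) (coherentFun ħ z₀ y)
      nlinarith [norm_nonneg (coherentFun ħ z y - coherentFun ħ z₀ y),
        sq_nonneg (‖coherentFun ħ z y‖ - ‖coherentFun ħ z₀ y‖)]
    · have h : Continuous fun z : Phase d =>
          ‖coherentFun ħ z y - coherentFun ħ z₀ y‖ ^ 2 := by
        unfold coherentFun
        fun_prop
      have h' := (ENNReal.continuous_ofReal.comp h).tendsto z₀
      rwa [Function.comp_apply, sub_self, norm_zero, zero_pow two_ne_zero, ENNReal.ofReal_zero] at h'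
  have h := ((ENNReal.continuous_rpow_const (y := 1 / 2)).tendsto _).comp hlim
  rw [ENNReal.zero_rpow_of_pos (by norm_num)] at h
  refine h.congr fun z => ?_
  rw [Function.comp_apply, edist_eq_enorm_sub, ← ENNReal.rpow_natCast, ← ENNReal.rpow_mul]
  norm_num

end Coherent

/-! ### Töplitz operators: positivity, trace and energy -/

section Toeplitz

variable {d : ℕ} {ħ : ℝ}

theorem norm_coherentState (hħ : 0 < ħ) (z : Phase d) : ‖coherentState hħ z‖ = 1 := by
  have h := enorm_coherentState_sq hħ z
  rw [← ofReal_norm, ← ENNReal.ofReal_pow (norm_nonneg _), ENNReal.ofReal_eq_one] at h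
  exact (pow_eq_one_iff_of_nonneg (norm_nonneg _) two_ne_zero).1 h

theorem integrable_rankOne_coherentState (hħ : 0 < ħ) (ν : Measure (Phase d)) [IsFiniteMeasure ν] :
    Integrable (fun z => InnerProductSpace.rankOne ℂ (coherentState hħ z) (coherentState hħ z))
      ν := by
  have hc := continuous_coherentState (d := d) hħ
  refine Integrable.of_bound (C := 1) ?_ (Filter.Eventually.of_forall fun z => ?_)
  · simp_rw [InnerProductSpace.rankOne_def']
    refine Continuous.aestronglyMeasurable (Continuous.clm_comp ?_ ((innerSL ℂ).continuous.comp hc))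
    exact (ContinuousLinearMap.toSpanSingletonCLE (𝕜 := ℂ)).continuous.comp hc
  · rw [InnerProductSpace.norm_rankOne, norm_coherentState, one_mul]

theorem toeplitz_eq_averageRankOne (hħ : 0 < ħ) (ν : Measure (Phase d)) :
    toeplitz hħ ν = averageRankOne ν (coherentState hħ) := rfl

theorem isPositive_toeplitz (hħ : 0 < ħ) (ν : Measure (Phase d)) [IsFiniteMeasure ν] :
    (toeplitz hħ ν).IsPositive :=
  isPositive_averageRankOne (integrable_rankOne_coherentState hħ ν)

theorem opTrace_toeplitz (hħ : 0 < ħ) (ν : Measure (Phase d)) [IsFiniteMeasure ν] :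
    opTrace (toeplitz hħ ν) = ν Set.univ := by
  rw [toeplitz_eq_averageRankOne, opTrace_averageRankOne
    (continuous_coherentState hħ).aestronglyMeasurable (integrable_rankOne_coherentState hħ ν)]
  simp [enorm_coherentState_sq]

theorem traceSandwich_positionForm_toeplitz_le (hħ : 0 < ħ) (ν : Measure (Phase d))
    [IsFiniteMeasure ν] (x : Space d) :
    traceSandwich (positionForm x) (toeplitz hħ ν) ≤
      ∫⁻ w, positionForm x (coherentState hħ w) ∂ν :=
  traceSandwich_positionForm_le (continuous_coherentState hħ).aestronglyMeasurable
    (integrable_rankOne_coherentState hħ ν) x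

theorem traceSandwich_momentumForm_toeplitz_le (hħ : 0 < ħ) (ν : Measure (Phase d))
    [IsFiniteMeasure ν] (ξ : Space d) :
    traceSandwich (momentumForm ħ ξ) (toeplitz hħ ν) ≤
      ∫⁻ w, momentumForm ħ ξ (coherentState hħ w) ∂ν :=
  traceSandwich_momentumForm_le (continuous_coherentState hħ).aestronglyMeasurable
    (integrable_rankOne_coherentState hħ ν) ħ ξ

theorem measurable_positionForm_coherentState (hħ : 0 < ħ) (x : Space d) :
    Measurable fun w => positionForm x (coherentState hħ w) := by
  simp_rw [positionForm_coherentState]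
  fun_prop

theorem traceSandwich_costForm_toeplitz_le (hħ : 0 < ħ) (lam : ℝ) (ν : Measure (Phase d))
    [IsFiniteMeasure ν] (z : Phase d) :
    traceSandwich (costForm ħ lam z) (toeplitz hħ ν) ≤
      ∫⁻ w, costForm ħ lam z (coherentState hħ w) ∂ν := by
  have hx := measurable_positionForm_coherentState hħ z.1
  rw [traceSandwich_costForm]
  simp only [costForm]
  rw [lintegral_add_left (hx.const_mul _), lintegral_const_mul _ hx]
  gcongr
  · exact traceSandwich_positionForm_toeplitz_le hħ ν z.1
  · exact traceSandwich_momentumForm_toeplitz_le hħ ν z.2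

theorem traceSandwich_oscillatorForm_toeplitz_le (hħ : 0 < ħ) (ν : Measure (Phase d))
    [IsFiniteMeasure ν] :
    traceSandwich (oscillatorForm ħ) (toeplitz hħ ν) ≤
      ∫⁻ w, oscillatorForm ħ (coherentState hħ w) ∂ν := by
  rw [traceSandwich_oscillatorForm]
  simp only [oscillatorForm]
  rw [lintegral_add_right _ (measurable_positionForm_coherentState hħ 0)]
  gcongr
  · exact traceSandwich_momentumForm_toeplitz_le hħ ν 0
  · exact traceSandwich_positionForm_toeplitz_le hħ ν 0

theorem isDensityOperatorTwo_toeplitz (hħ : 0 < ħ) (μ : Measure (Phase d))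
    [IsProbabilityMeasure μ] (hμ : HasFiniteSecondMoment μ) :
    IsDensityOperatorTwo ħ (toeplitz hħ μ) := by
  refine ⟨⟨isPositive_toeplitz hħ μ, by rw [opTrace_toeplitz, measure_univ]⟩, ?_⟩
  refine (traceSandwich_oscillatorForm_toeplitz_le hħ μ).trans_lt ?_
  simp_rw [oscillatorForm_coherentState]
  rw [lintegral_add_right _ measurable_const]
  exact ENNReal.add_lt_top.2
    ⟨hμ, by rw [lintegral_const, measure_univ, mul_one]; exact ENNReal.ofReal_lt_top⟩

end Toeplitz

/-! ### Quantum couplings from classical couplings -/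

section Coupling

open ProbabilityTheory

variable {d : ℕ} {ħ : ℝ}

/-- The operator-valued density obtained from the disintegration `f(z) κ(z, dw) dz` of a classical
coupling by Töplitz quantization in the variable `w`. -/
noncomputable def kernelCoupling (hħ : 0 < ħ) (f : Phase d → ℝ) (κ : Kernel (Phase d) (Phase d))
    (z : Phase d) : Op d :=
  toeplitz hħ (ENNReal.ofReal (f z) • κ z)

theorem isCoupling_kernelCoupling (hħ : 0 < ħ) {f : Phase d → ℝ} (hf : IsProbDensity f)
    (κ : Kernel (Phase d) (Phase d)) [IsMarkovKernel κ] {μ : Measure (Phase d)} [IsFiniteMeasure μ]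
    (hμ : (densityMeasure f ⊗ₘ κ).map Prod.snd = μ) :
    IsCoupling f (toeplitz hħ μ) (kernelCoupling hħ f κ) := by
  have hfm : AEMeasurable (fun z => ENNReal.ofReal (f z)) := hf.1.1.aemeasurable.ennreal_ofReal
  have : IsFiniteMeasure (densityMeasure f) :=
    isFiniteMeasure_withDensity_ofReal hf.1.2
  have hfin : ∀ z, IsFiniteMeasure (ENNReal.ofReal (f z) • κ z) := fun z =>
    Measure.smul_finite _ ENNReal.ofReal_ne_top
  have hinner : ∀ φ ψ : Hilb d, ∀ z, inner ℂ φ (kernelCoupling hħ f κ z ψ) =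
      (ENNReal.ofReal (f z)).toReal •
        ∫ w, inner ℂ (coherentState hħ w) ψ * inner ℂ φ (coherentState hħ w) ∂κ z := by
    intro φ ψ z
    have := hfin z
    rw [kernelCoupling, toeplitz_eq_averageRankOne,
      inner_averageRankOne (integrable_rankOne_coherentState hħ _), integral_smul_measure]
  have hcont : ∀ φ ψ : Hilb d, Continuous fun w =>
      inner ℂ (coherentState hħ w) ψ * inner ℂ φ (coherentState hħ w) := by
    intro φ ψ
    have := continuous_coherentState (d := d) hħ
    fun_prop
  refine ⟨fun φ ψ => ?_, ?_, ?_, fun φ ψ => ?_⟩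
  · simp_rw [hinner]
    refine hfm.ennreal_toReal.smul ?_
    exact ((hcont φ ψ).stronglyMeasurable.integral_kernel).measurable.aemeasurable
  -- No exceptional set is needed: `ENNReal.ofReal` replaces negative values of f by 0.
  · refine Filter.Eventually.of_forall fun z => ?_
    have := hfin z
    exact isPositive_toeplitz hħ _
  · refine Filter.Eventually.of_forall fun z => ?_
    have := hfin z
    rw [kernelCoupling, opTrace_toeplitz]
    simp
  · simp_rw [hinner]
    have hi : Integrable (fun w : Phase d × Phase d =>
        inner ℂ (coherentState hħ w.2) ψ * inner ℂ φ (coherentState hħ w.2))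
        (densityMeasure f ⊗ₘ κ) := by
      have h := integrable_inner_mul_inner (integrable_rankOne_coherentState hħ μ) φ ψ
      rw [← hμ] at h
      exact h.comp_measurable measurable_snd
    -- The weight f(z) is absorbed into the measure. The iterated integral is then one over the
    -- joint measure, whose integrand depends on w alone, so only the marginal μ matters.
    rw [← integral_withDensity_eq_integral_toReal_smul₀ hfm
      (Filter.Eventually.of_forall fun z => ENNReal.ofReal_lt_top)]
    change ∫ z, _ ∂(densityMeasure f) = _
    rw [← Measure.integral_compProd hi, toeplitz_eq_averageRankOne,
      inner_averageRankOne (integrable_rankOne_coherentState hħ _), ← hμ,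
      integral_map measurable_snd.aemeasurable (hcont φ ψ).aestronglyMeasurable]

theorem lintegral_traceSandwich_kernelCoupling_le (hħ : 0 < ħ) (lam : ℝ) {f : Phase d → ℝ}
    (hf : IsProbDensity f) (κ : Kernel (Phase d) (Phase d)) [IsMarkovKernel κ] :
    ∫⁻ z, traceSandwich (costForm ħ lam z) (kernelCoupling hħ f κ z) ≤
      ∫⁻ w, costForm ħ lam w.1 (coherentState hħ w.2) ∂(densityMeasure f ⊗ₘ κ) := by
  have hfm : AEMeasurable (fun z => ENNReal.ofReal (f z)) := hf.1.1.aemeasurable.ennreal_ofReal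
  have : IsFiniteMeasure (densityMeasure f) :=
    isFiniteMeasure_withDensity_ofReal hf.1.2
  have hm : Measurable fun w : Phase d × Phase d =>
      costForm ħ lam w.1 (coherentState hħ w.2) := by
    simp_rw [costForm_coherentState]
    fun_prop
  rw [Measure.lintegral_compProd hm, densityMeasure,
    lintegral_withDensity_eq_lintegral_mul₀ hfm hm.lintegral_kernel_prod_right.aemeasurable]
  refine lintegral_mono fun z => ?_
  have : IsFiniteMeasure (ENNReal.ofReal (f z) • κ z) :=
    Measure.smul_finite _ ENNReal.ofReal_ne_top
  refine (traceSandwich_costForm_toeplitz_le hħ lam _ z).trans ?_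
  rw [lintegral_smul_measure]
  rfl

theorem pseudoDist_toeplitz_sq_le (hħ : 0 < ħ) (lam : ℝ) {f : Phase d → ℝ} (hf : IsProbDensity f)
    {μ : Measure (Phase d)} [IsProbabilityMeasure μ] {P : Measure (Phase d × Phase d)}
    (hP : P ∈ classicalCouplings (densityMeasure f) μ) :
    pseudoDist ħ lam f (toeplitz hħ μ) ^ 2 ≤
      ENNReal.ofReal (max 1 (lam ^ 2)) *
          ∫⁻ w, ENNReal.ofReal (‖w.1.1 - w.2.1‖ ^ 2 + ‖w.1.2 - w.2.2‖ ^ 2) ∂P +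
        ENNReal.ofReal ((lam ^ 2 + 1) * d * ħ / 2) := by
  obtain ⟨hP1, hP2⟩ := hP
  -- P inherits total mass 1 from its marginal μ. This permits disintegration, and makes the
  -- constant term integrate to itself.
  have hPp : IsProbabilityMeasure P := by
    constructor
    have h := congrArg (fun m => m Set.univ) hP2
    simpa [Measure.map_apply measurable_snd MeasurableSet.univ] using h
  have hdis : densityMeasure f ⊗ₘ P.condKernel = P := by
    rw [← hP1]
    exact P.disintegrate P.condKernel
  have hcoup := isCoupling_kernelCoupling hħ hf P.condKernel (μ := μ) (by rw [hdis, hP2])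
  have h1 : pseudoDist ħ lam f (toeplitz hħ μ) ≤
      (∫⁻ z, traceSandwich (costForm ħ lam z) (kernelCoupling hħ f P.condKernel z)) ^
        (1 / 2 : ℝ) :=
    iInf₂_le (kernelCoupling hħ f P.condKernel) hcoup
  have h2 := lintegral_traceSandwich_kernelCoupling_le hħ lam hf P.condKernel
  rw [hdis] at h2
  calc pseudoDist ħ lam f (toeplitz hħ μ) ^ 2
      ≤ ((∫⁻ z, traceSandwich (costForm ħ lam z) (kernelCoupling hħ f P.condKernel z)) ^
        (1 / 2 : ℝ)) ^ 2 := by gcongr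
    _ = ∫⁻ z, traceSandwich (costForm ħ lam z) (kernelCoupling hħ f P.condKernel z) := by
        rw [← ENNReal.rpow_natCast, ← ENNReal.rpow_mul]
        norm_num
    _ ≤ ∫⁻ w, costForm ħ lam w.1 (coherentState hħ w.2) ∂P := h2
    _ ≤ ∫⁻ w, (ENNReal.ofReal (max 1 (lam ^ 2)) *
          ENNReal.ofReal (‖w.1.1 - w.2.1‖ ^ 2 + ‖w.1.2 - w.2.2‖ ^ 2) +
            ENNReal.ofReal ((lam ^ 2 + 1) * d * ħ / 2)) ∂P := by
        refine lintegral_mono fun w => ?_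
        rw [costForm_coherentState, ← ENNReal.ofReal_mul (by positivity),
          ← ENNReal.ofReal_add (by positivity) (by positivity)]
        refine ENNReal.ofReal_le_ofReal ?_
        have h3 := mul_le_mul_of_nonneg_right (le_max_right 1 (lam ^ 2))
          (sq_nonneg ‖w.1.1 - w.2.1‖)
        have h4 := mul_le_mul_of_nonneg_right (le_max_left 1 (lam ^ 2))
          (sq_nonneg ‖w.1.2 - w.2.2‖)
        linarith
    _ = _ := by
        rw [lintegral_add_right _ measurable_const, lintegral_const_mul _ (by fun_prop),
          lintegral_const, measure_univ, mul_one]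

end Coupling

end QuantumTransport

theorem proposition2p3 (d : ℕ) (ħ : ℝ) (hħ : 0 < ħ) (lam : ℝ)
    (f : QuantumTransport.Phase d → ℝ) (hf : QuantumTransport.IsProbDensity f)
    (μ : MeasureTheory.Measure (QuantumTransport.Phase d))
    [MeasureTheory.IsProbabilityMeasure μ]
    (hμ : QuantumTransport.HasFiniteSecondMoment μ) :
    QuantumTransport.IsDensityOperatorTwo ħ (QuantumTransport.toeplitz hħ μ) ∧
    QuantumTransport.pseudoDist ħ lam f (QuantumTransport.toeplitz hħ μ) ^ 2 ≤
      ENNReal.ofReal (max 1 (lam ^ 2)) *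
          QuantumTransport.distMK2 (QuantumTransport.densityMeasure f) μ ^ 2 +
        ENNReal.ofReal ((lam ^ 2 + 1) * d * ħ / 2) := by
  refine ⟨QuantumTransport.isDensityOperatorTwo_toeplitz hħ μ hμ, ?_⟩
  have hM : ENNReal.ofReal (max 1 (lam ^ 2)) ≠ 0 :=
    (ENNReal.ofReal_pos.2 (lt_max_of_lt_left one_pos)).ne'
  -- The inequality is solved for the distance, so that the infimum stands alone on the right and
  -- each P can be treated separately. Dividing is legitimate because max(1, λ²) is nonzero and
  -- finite.
  rw [← tsub_le_iff_right, mul_comm (ENNReal.ofReal (max 1 _)),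
    ← ENNReal.div_le_iff hM ENNReal.ofReal_ne_top,
    ← ENNReal.rpow_natCast (QuantumTransport.distMK2 _ _), ← ENNReal.rpow_inv_le_iff (by norm_num)]
  refine le_iInf₂ fun P hP => ?_
  rw [Nat.cast_ofNat, one_div]
  refine ENNReal.rpow_le_rpow ?_ (by norm_num)
  rw [ENNReal.div_le_iff hM ENNReal.ofReal_ne_top, tsub_le_iff_right, mul_comm (lintegral _ _)]
  exact QuantumTransport.pseudoDist_toeplitz_sq_le hħ lam hf hP
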